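/- Fix an integer $e\ge 2$. An *arm sequence* is a sequence $A=(A_1,A_2,\dots)$ of integers such that $t-1\le A_t\le (e-1)t$ for all $t\ge1$ and $A_{t+u}\in\{A_t+A_u,\,A_t+A_u+1\}$ for all $t,u\ge1$; we read $A_0$ as $0$. Partitions are identified with their Young diagrams in English notation; a *node* is a pair (row, column) $(r,c)$ of positive integers, its *residue* is $c-r+e\mathbb Z$, and an *$i$-node* is a node of residue $i\in\mathbb Z/e\mathbb Z$. The hook of a partition $\lambda$ at a node $(r,c)$ of $\lambda$ consists of $(r,c)$ and all nodes of $\lambda$ directly to the right of or directly below it; its length is its number of nodes, and its arm length is the number of nodes to the right of $(r,c)$. Say that $\lambda$ is *$A$-regular* if, for every $t\ge1$, it has no hook of length $et$ and arm length $A_t$. For distinct $i$-nodes $(r,c),(s,d)$, named so that $s-r+c-d=et$ with $t\ge0$, put $(r,c)\prec(s,d)$ if $c-d\le A_t$, and $(r,c)\succ(s,d)$ otherwise; this is a total order on $i$-nodes. For a partition $\lambda$, list its addable and removable $i$-nodes in decreasing order, write $+$ for each addable and $-$ for each removable node, and repeatedly delete adjacent pairs $+-$. If a $+$ remains, let $f_i\lambda$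 be the partition obtained from $\lambda$ by adding the node corresponding to the first remaining $+$; otherwise put $f_i\lambda=0$. Let $\mathcal R_A$ be the directed graph with arrows labelled by $\mathbb Z/e\mathbb Z$ whose vertices are the $A$-regular partitions, with an arrow $\lambda\xrightarrow{\,i\,}\mu$ whenever $f_i\lambda=\mu$. For $n\ge0$, let $\mathcal R_A^{(n)}$ be its induced subgraph on the $A$-regular partitions of size at most $ne$. An *isomorphism* between two such graphs is a bijection $\alpha$ of the vertex sets such that there is an arrow $b\xrightarrow{\,i\,}c$ if and only if there is an arrow $\alpha(b)\xrightarrow{\,i\,}\alpha(c)$. **Proposition.** Let $A$ be an arm sequence. Then the only isomorphism from $\mathcal R_A$ to $\mathcal R_A$ is the identity. For every integer $n\ge0$, the only isomorphism from $\mathcal R_A^{(n)}$ to $\mathcal R_A^{(n)}$ is the identity. -/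

import Mathlib

namespace ArmCrystal

/-- A node `(r, c)`: row `r`, column `c`. As in `YoungDiagram`, rows and columns are numbered
from `0`; all conditions below only involve differences of coordinates. -/
abbrev Node : Type := ℕ × ℕ

/-- Arm sequences `(A_1, A_2, …)`, with the usual convention that `A_0` is read as `0`. -/
structure IsArmSequence (e : ℕ) (A : ℕ → ℤ) : Prop where
  zero : A 0 = 0
  lower : ∀ t : ℕ, 1 ≤ t → (t : ℤ) - 1 ≤ A t
  upper : ∀ t : ℕ, 1 ≤ t → A t ≤ ((e : ℤ) - 1) * t
  add : ∀ t u : ℕ, 1 ≤ t → 1 ≤ u → A (t + u) = A t + A u ∨ A (t + u) = A t + A u + 1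

/-- The residue `c - r + eℤ` of the node `(r, c)`. -/
def residue (e : ℕ) (x : Node) : ZMod e := (((x.2 : ℤ) - (x.1 : ℤ) : ℤ) : ZMod e)

/-- The number of nodes of `μ` strictly to the right of the node `x` of `μ`. -/
def armLength (μ : YoungDiagram) (x : Node) : ℕ := μ.rowLen x.1 - (x.2 + 1)

/-- The number of nodes of `μ` strictly below the node `x` of `μ`. -/
def legLength (μ : YoungDiagram) (x : Node) : ℕ := μ.colLen x.2 - (x.1 + 1)

/-- The length of the hook of `μ` at the node `x` of `μ`. -/
def hookLength (μ : YoungDiagram) (x : Node) : ℕ := armLength μ x + legLength μ x + 1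

/-- `μ` is `A`-regular: no hook of `μ` has length `e t` and arm length `A_t`, for any `t ≥ 1`. -/
def IsRegular (e : ℕ) (A : ℕ → ℤ) (μ : YoungDiagram) : Prop :=
  ∀ x ∈ μ, ∀ t : ℕ, 1 ≤ t → ¬ (hookLength μ x = e * t ∧ (armLength μ x : ℤ) = A t)

/-- `x` is a removable node of `μ`. -/
def IsRemovable (μ : YoungDiagram) (x : Node) : Prop :=
  x ∈ μ ∧ ∃ ν : YoungDiagram, ν.cells = μ.cells.erase x

/-- `x` is an addable node of `μ`. -/
def IsAddable (μ : YoungDiagram) (x : Node) : Prop :=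
  x ∉ μ ∧ ∃ ν : YoungDiagram, ν.cells = insert x μ.cells

/-- The strict order `x ≺ y` on nodes of the same residue. For distinct nodes `x = (r, c)` and
`y = (s, d)` with `s - r + c - d = e t`: if `t ≥ 0`, then `x ≺ y` iff `c - d ≤ A_t`; if `t ≤ 0`, the
roles are interchanged, and `x ≺ y` iff not `d - c ≤ A_{-t}`. (For `t = 0` both clauses say
`c < d`.) -/
def NodeLT (e : ℕ) (A : ℕ → ℤ) (x y : Node) : Prop :=
  x ≠ y ∧
    ((∃ t : ℕ, (y.1 : ℤ) - x.1 + x.2 - y.2 = e * t ∧ (x.2 : ℤ) - y.2 ≤ A t) ∨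
     (∃ t : ℕ, (x.1 : ℤ) - y.1 + y.2 - x.2 = e * t ∧ ¬ ((y.2 : ℤ) - x.2 ≤ A t)))

open Classical in
/-- The finite set of all addable and removable `i`-nodes of `μ`. (Each addable or removable node
`(r, c)` of `μ` has `r, c ≤ |μ|`, so restricting to this box loses nothing.) -/
noncomputable def signatureNodes (e : ℕ) (i : ZMod e) (μ : YoungDiagram) : Finset Node :=
  (Finset.range (μ.card + 1) ×ˢ Finset.range (μ.card + 1)).filter
    fun x => residue e x = i ∧ (IsAddable μ x ∨ IsRemovable μ x)

/-- The signs in a signature. -/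
inductive Sign : Type
  | plus
  | minus

open Classical in
/-- The `i`-signature of `μ` with respect to `A`: the addable and removable `i`-nodes of `μ` listed
in decreasing order for `≺`, each with the sign `+` if it is addable and `-` if it is removable. -/
noncomputable def signature (e : ℕ) (A : ℕ → ℤ) (i : ZMod e) (μ : YoungDiagram) :
    List (Sign × Node) :=
  ((signatureNodes e i μ).toList.mergeSort fun x y => decide (x = y ∨ NodeLT e A y x)).map
    fun x => (if IsAddable μ x then Sign.plus else Sign.minus, x)

/-- Put one more signed node in front of an already reduced sequence, deleting the adjacent
pair `+-` if this creates one. -/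
def consReduce : Sign × Node → List (Sign × Node) → List (Sign × Node)
  | (Sign.plus, _), (Sign.minus, _) :: l => l
  | a, l => a :: l

/-- The reduction of a sequence of signed nodes: the sequence without adjacent pairs `+-`
which is obtained by repeatedly deleting such pairs. -/
def reduction (l : List (Sign × Node)) : List (Sign × Node) := l.foldr consReduce []

/-- The nodes, in order, of the entries with sign `+`. -/
def plusNodes : List (Sign × Node) → List Node
  | [] => []
  | (Sign.plus, x) :: l => x :: plusNodes l
  | (Sign.minus, _) :: l => plusNodes l

/-- `x` is the cogood `i`-node of `μ`: the node of the first `+` in the reduced `i`-signature. -/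
def IsCogood (e : ℕ) (A : ℕ → ℤ) (i : ZMod e) (μ : YoungDiagram) (x : Node) : Prop :=
  (plusNodes (reduction (signature e A i μ))).head? = some x

/-- The relation `f_i μ = ν`: the partition `μ` has a cogood `i`-node `x`, and `ν = μ ∪ {x}`. -/
def FOpEq (e : ℕ) (A : ℕ → ℤ) (i : ZMod e) (μ ν : YoungDiagram) : Prop :=
  ∃ x : Node, IsCogood e A i μ x ∧ ν.cells = insert x μ.cells

/-- A directed graph with vertex set `V` and arrows labelled by `I`. -/
structure LabelledDigraph (I V : Type) : Type where
  arrow : I → V → V → Prop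

/-- The subgraph induced on a set of vertices. -/
def LabelledDigraph.induce {I V : Type} (G : LabelledDigraph I V) (S : Set V) :
    LabelledDigraph I S where
  arrow i b c := G.arrow i b c

/-- An isomorphism: a bijection `α` between the vertex sets such that there is an arrow labelled
`i` from `b` to `c` iff there is one from `α b` to `α c`. -/
def IsCrystalIso {I V W : Type} (G : LabelledDigraph I V) (H : LabelledDigraph I W)
    (α : V ≃ W) : Prop :=
  ∀ (i : I) (b c : V), G.arrow i b c ↔ H.arrow i (α b) (α c)

/-- The vertex set of the crystal `R_A`: the `A`-regular partitions. -/
abbrev RegularPartition (e : ℕ) (A : ℕ → ℤ) : Type := {μ : YoungDiagram // IsRegular e A μ}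

/-- The crystal (graph) `R_A`: there is an arrow labelled `i` from `b` to `c` iff `f_i b = c`. -/
def crystal (e : ℕ) (A : ℕ → ℤ) : LabelledDigraph (ZMod e) (RegularPartition e A) where
  arrow i b c := FOpEq e A i b.1 c.1

/-- The `A`-regular partitions of size at most `n e`. -/
def sizeAtMost (e : ℕ) (A : ℕ → ℤ) (n : ℕ) : Set (RegularPartition e A) :=
  {b | b.1.card ≤ n * e}

/-- The truncated crystal: the subgraph of `R_A` induced on partitions of size at most `n e`. -/
def truncatedCrystal (e : ℕ) (A : ℕ → ℤ) (n : ℕ) :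
    LabelledDigraph (ZMod e) (sizeAtMost e A n) :=
  (crystal e A).induce (sizeAtMost e A n)

end ArmCrystal

/-! An arrow raises the size by one and is determined by its source and label. So an automorphism is
the identity by induction on size, once every nonempty `A`-regular partition is known to be `f_i` of
an `A`-regular partition (`exists_fOpEq`). Since predecessors are smaller, truncation by size does
no harm.

Encode μ by S = `rim μ`. Its steps are 0 or 1, and its second difference is 1 at contents of addable
nodes, -1 at contents of removable nodes, 0 elsewhere. With A extended to negative indices, the node
order is a single inequality, and regularity says that for t ≥ 1 the quantity S(y + et) - S(y) - A_t
never drops from 1 to 0 as y grows by one. Hence, for each t ≠ 0, the y with S(y + et) - S(y) > A_t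
form a half-line, and the curvature at y + et summed over it telescopes to 0
(`sum_curvature_eq_zero`).

Summing over t as well, the weights (number of + minus number of -) of the nodes lying above y,
added over all contents y, give 0. If no signature had a prefix of negative weight, each term would
be nonnegative, hence 0; but for y the content of a removable p, the prefix ending at p would then
have weight -1 (`exists_prefix_weight_neg`).

So some signature has an uncancelled -. Let p be the last one. After removing p its sign becomes the
first uncancelled +, so f_i puts p back (`head?_plusNodes_reduction`). A forbidden hook created by
removing p would give a removable r ≺ p too close to p to leave room for the addable node that must
lie between them (`rimRegular_erase`). -/

namespace ArmCrystal

/-! ### Arm sequences indexed by all integers, and the node order -/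

/-- The extension of an arm sequence to all integers, with `A_{-t} = -A_t - 1` for `t ≥ 1`. -/
def extend (A : ℕ → ℤ) : ℤ → ℤ
  | Int.ofNat n => A n
  | Int.negSucc n => -A (n + 1) - 1

section Extend

variable {e : ℕ} {A : ℕ → ℤ}

theorem extend_natCast (A : ℕ → ℤ) (n : ℕ) : extend A (n : ℤ) = A n := rfl

theorem extend_neg (A : ℕ → ℤ) {t : ℤ} (ht : 1 ≤ t) : extend A (-t) = -extend A t - 1 := by
  obtain ⟨n, rfl⟩ : ∃ n : ℕ, t = (n : ℤ) + 1 := ⟨(t - 1).toNat, by omega⟩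
  have h : -((n : ℤ) + 1) = Int.negSucc n := by omega
  rw [h]
  rfl

theorem IsArmSequence.add_bounds (hA : IsArmSequence e A) (m n : ℕ) :
    A m + A n ≤ A (m + n) ∧ A (m + n) ≤ A m + A n + 1 := by
  rcases Nat.eq_zero_or_pos m with rfl | hm
  · simp [hA.zero]
  rcases Nat.eq_zero_or_pos n with rfl | hn
  · simp [hA.zero]
  rcases hA.add m n hm hn with h | h <;> omega

theorem IsArmSequence.extend_zero (hA : IsArmSequence e A) : extend A 0 = 0 := hA.zero

theorem IsArmSequence.extend_add_of_nonneg (hA : IsArmSequence e A) {t u : ℤ} (ht : 0 ≤ t)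
    (hu : 0 ≤ u) : extend A t + extend A u ≤ extend A (t + u) ∧
      extend A (t + u) ≤ extend A t + extend A u + 1 := by
  lift t to ℕ using ht
  lift u to ℕ using hu
  exact hA.add_bounds t u

/-- Moving negative indices across the sum by A_{-t} = -A_t - 1 swaps the two inequalities for
positive indices; the -1 is what makes the window of width one match again. -/
theorem IsArmSequence.extend_add (hA : IsArmSequence e A) (t u : ℤ) :
    extend A t + extend A u ≤ extend A (t + u) ∧
      extend A (t + u) ≤ extend A t + extend A u + 1 := by
  have key : ∀ t u : ℤ, 0 ≤ t → u < 0 → extend A t + extend A u ≤ extend A (t + u) ∧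
      extend A (t + u) ≤ extend A t + extend A u + 1 := by
    intro t u ht hu
    have hu' := extend_neg A (t := -u) (by omega)
    rw [neg_neg] at hu'
    rcases le_or_gt 0 (t + u) with h | h
    · have := hA.extend_add_of_nonneg (t := t + u) (u := -u) h (by omega)
      rw [add_neg_cancel_right] at this
      omega
    · have h1 := hA.extend_add_of_nonneg (t := t) (u := -(t + u)) ht (by omega)
      have h2 := extend_neg A (t := -(t + u)) (by omega)
      rw [neg_neg] at h2
      rw [show t + -(t + u) = -u by ring] at h1
      omega
  rcases le_or_gt 0 t with ht | ht <;> rcases le_or_gt 0 u with hu | hu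
  · exact hA.extend_add_of_nonneg ht hu
  · exact key t u ht hu
  · have := key u t hu ht
    rw [add_comm u t] at this
    omega
  · have h1 := hA.extend_add_of_nonneg (t := -t) (u := -u) (by omega) (by omega)
    have h2 := extend_neg A (t := -t) (by omega)
    have h3 := extend_neg A (t := -u) (by omega)
    have h4 := extend_neg A (t := -t + -u) (by omega)
    rw [neg_neg] at h2 h3
    rw [show -(-t + -u) = t + u by ring] at h4
    omega

theorem IsArmSequence.le_extend (hA : IsArmSequence e A) {t : ℤ} (ht : 1 ≤ t) :
    t - 1 ≤ extend A t := by
  lift t to ℕ using (by omega)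
  exact hA.lower t (by omega)

theorem IsArmSequence.extend_le (hA : IsArmSequence e A) {t : ℤ} (ht : 1 ≤ t) :
    extend A t ≤ ((e : ℤ) - 1) * t := by
  lift t to ℕ using (by omega)
  exact hA.upper t (by omega)

end Extend

/-- The content of a node. -/
def content (x : Node) : ℤ := (x.2 : ℤ) - x.1

/-- With negative t allowed, the two clauses of the order merge into one, and transitivity becomes
superadditivity of the extended sequence. -/
theorem nodeLT_iff {e : ℕ} {A : ℕ → ℤ} (he : 0 < e) (hA : IsArmSequence e A) (x y : Node) :
    NodeLT e A x y ↔
      ∃ t : ℤ, content y = content x + e * t ∧ extend A t < (y.2 : ℤ) - x.2 := by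
  obtain ⟨r, c⟩ := x
  obtain ⟨s, d⟩ := y
  simp only [NodeLT, content, ne_eq, Prod.mk.injEq]
  constructor
  · rintro ⟨hne, ⟨t, h1, h2⟩ | ⟨t, h1, h2⟩⟩
    · refine ⟨-t, by linarith, ?_⟩
      rcases Nat.eq_zero_or_pos t with rfl | ht
      · simp only [Nat.cast_zero, neg_zero, hA.extend_zero]
        rw [hA.zero] at h2
        simp only [Nat.cast_zero, mul_zero] at h1
        omega
      · rw [extend_neg A (by omega), extend_natCast]
        omega
    · exact ⟨t, by linarith, by rw [extend_natCast]; omega⟩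
  · rintro ⟨t, h1, h2⟩
    have hne : ¬(r = s ∧ c = d) := by
      rintro ⟨rfl, rfl⟩
      have : t = 0 := by
        have : (e : ℤ) * t = 0 := by linarith
        rcases mul_eq_zero.1 this with h | h
        · omega
        · exact h
      rw [this, hA.extend_zero] at h2
      omega
    refine ⟨hne, ?_⟩
    rcases le_or_gt 0 t with ht | ht
    · lift t to ℕ using ht
      exact Or.inr ⟨t, by linarith, by rw [extend_natCast] at h2; omega⟩
    · refine Or.inl ⟨(-t).toNat, ?_, ?_⟩
      · rw [Int.toNat_of_nonneg (by omega)]; linarith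
      · have h3 := extend_neg A (t := -t) (by omega)
        have h4 := extend_natCast A (-t).toNat
        rw [Int.toNat_of_nonneg (by omega)] at h4
        rw [neg_neg] at h3
        omega

section Order

variable {e : ℕ} {A : ℕ → ℤ}

theorem NodeLT.trans (he : 0 < e) (hA : IsArmSequence e A) {x y z : Node}
    (hxy : NodeLT e A x y) (hyz : NodeLT e A y z) : NodeLT e A x z := by
  rw [nodeLT_iff he hA] at *
  obtain ⟨t, h1, h2⟩ := hxy
  obtain ⟨u, h3, h4⟩ := hyz
  have := hA.extend_add t u
  exact ⟨t + u, by rw [h3, h1]; ring, by omega⟩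

theorem NodeLT.asymm (he : 0 < e) (hA : IsArmSequence e A) {x y : Node}
    (hxy : NodeLT e A x y) : ¬ NodeLT e A y x :=
  fun hyx => (NodeLT.trans he hA hxy hyx).1 rfl

theorem residue_eq_intCast_iff (x : Node) (p : ℤ) :
    residue e x = (p : ZMod e) ↔ ∃ t : ℤ, content x = p + e * t := by
  rw [residue, ZMod.intCast_eq_intCast_iff_dvd_sub]
  constructor
  · rintro ⟨t, ht⟩
    exact ⟨-t, by rw [content]; linarith⟩
  · rintro ⟨t, ht⟩
    exact ⟨-t, by rw [content] at ht; linarith⟩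

theorem nodeLT_total (he : 0 < e) (hA : IsArmSequence e A) {x y : Node}
    (h : residue e x = residue e y) : x = y ∨ NodeLT e A x y ∨ NodeLT e A y x := by
  obtain ⟨t, ht⟩ := (residue_eq_intCast_iff (e := e) x (content y)).1 h
  rw [nodeLT_iff he hA, nodeLT_iff he hA]
  rcases lt_trichotomy t 0 with h0 | rfl | h0
  · have := extend_neg A (t := -t) (by omega)
    rw [neg_neg] at this
    by_cases h1 : extend A t < (x.2 : ℤ) - y.2
    · exact Or.inr (Or.inr ⟨t, ht, h1⟩)
    · exact Or.inr (Or.inl ⟨-t, by rw [ht]; ring, by omega⟩)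
  · rw [mul_zero, add_zero] at ht
    rcases lt_trichotomy x.2 y.2 with h1 | h1 | h1
    · exact Or.inr (Or.inl ⟨0, by rw [ht]; ring, by rw [hA.extend_zero]; omega⟩)
    · left
      simp only [content] at ht
      ext <;> omega
    · exact Or.inr (Or.inr ⟨0, by rw [ht]; ring, by rw [hA.extend_zero]; omega⟩)
  · have := extend_neg A (t := t) (by omega)
    by_cases h1 : extend A t < (x.2 : ℤ) - y.2
    · exact Or.inr (Or.inr ⟨t, ht, h1⟩)
    · exact Or.inr (Or.inl ⟨-t, by rw [ht]; ring, by omega⟩)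

end Order

/-! ### The rim function of a partition -/

theorem exists_diagonal_notMem (μ : YoungDiagram) (x : ℤ) :
    ∃ k : ℕ, (k + (-x).toNat, k + x.toNat) ∉ μ := by
  refine ⟨μ.rowLen 0, fun h => ?_⟩
  have h1 : (0, μ.rowLen 0) ∈ μ := μ.up_left_mem (Nat.zero_le _) (Nat.le_add_right _ _) h
  exact lt_irrefl _ (YoungDiagram.mem_iff_lt_rowLen.1 h1)

open Classical in
/-- The column of the first node of content `x` outside `μ`. -/
noncomputable def rim (μ : YoungDiagram) (x : ℤ) : ℤ :=
  (Nat.find (exists_diagonal_notMem μ x) + x.toNat : ℕ)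

section Rim

variable (μ : YoungDiagram)

theorem mem_iff_lt_rim (r c : ℕ) : (r, c) ∈ μ ↔ (c : ℤ) < rim μ ((c : ℤ) - r) := by
  classical
  set x : ℤ := (c : ℤ) - r with hx
  have hr : r = min r c + (-x).toNat := by omega
  have hc : c = min r c + x.toNat := by omega
  have hfind := Nat.find_spec (exists_diagonal_notMem μ x)
  have hmin := fun m => Nat.find_min (exists_diagonal_notMem μ x) (m := m)
  simp only [rim]
  set k := Nat.find (exists_diagonal_notMem μ x)
  constructor
  · intro h
    by_contra hlt
    exact hfind (μ.up_left_mem (by omega) (by omega) h)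
  · intro h
    have := hmin (min r c) (by omega)
    rwa [not_not, ← hr, ← hc] at this

theorem rim_nonneg (x : ℤ) : 0 ≤ rim μ x := Int.natCast_nonneg _

theorem le_rim (x : ℤ) : x ≤ rim μ x := by
  simp only [rim]
  omega

theorem mem_of_lt_rim {r c x : ℤ} (hr : 0 ≤ r) (hc : 0 ≤ c) (hx : c - r = x) (h : c < rim μ x) :
    (r.toNat, c.toNat) ∈ μ := by
  rw [mem_iff_lt_rim, Int.toNat_of_nonneg hr, Int.toNat_of_nonneg hc, hx]
  exact h

theorem notMem_of_rim_le {r c x : ℤ} (hr : 0 ≤ r) (hc : 0 ≤ c) (hx : c - r = x)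
    (h : rim μ x ≤ c) : (r.toNat, c.toNat) ∉ μ := by
  rw [mem_iff_lt_rim, Int.toNat_of_nonneg hr, Int.toNat_of_nonneg hc, hx]
  exact not_lt.2 h

theorem rim_le_rim_succ (x : ℤ) : rim μ x ≤ rim μ (x + 1) := by
  by_contra! h
  have h0 := rim_nonneg μ (x + 1)
  have h1 := le_rim μ (x + 1)
  refine notMem_of_rim_le μ (r := rim μ (x + 1) - x - 1) (c := rim μ (x + 1)) (x := x + 1)
    (by omega) h0 (by ring) le_rfl ?_
  exact μ.up_left_mem (by omega) le_rfl
    (mem_of_lt_rim μ (r := rim μ (x + 1) - x) (c := rim μ (x + 1)) (by omega) h0 (by ring) h)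

theorem rim_succ_le (x : ℤ) : rim μ (x + 1) ≤ rim μ x + 1 := by
  by_contra! h
  have h0 := rim_nonneg μ x
  have h1 := le_rim μ x
  refine notMem_of_rim_le μ (r := rim μ x - x) (c := rim μ x) (x := x)
    (by omega) h0 (by ring) le_rfl ?_
  exact μ.up_left_mem le_rfl (by omega)
    (mem_of_lt_rim μ (r := rim μ x - x) (c := rim μ x + 1) (x := x + 1) (by omega) (by omega)
      (by ring) h)

/-- The two lower bounds guarantee that the node of content x in column T x exists, so membership on
that diagonal pins down T x. -/
theorem rim_unique (T : ℤ → ℤ) (h0 : ∀ x, 0 ≤ T x) (h1 : ∀ x, x ≤ T x)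
    (h : ∀ r c : ℕ, (r, c) ∈ μ ↔ (c : ℤ) < T ((c : ℤ) - r)) : rim μ = T := by
  funext x
  have aux : ∀ U : ℤ, 0 ≤ U → x ≤ U → (((U - x).toNat, U.toNat) ∈ μ ↔ U < T x) := by
    intro U hU hx
    rw [h, Int.toNat_of_nonneg hU, Int.toNat_of_nonneg (by omega), show U - (U - x) = x by ring]
  have h2 := aux (rim μ x) (rim_nonneg μ x) (le_rim μ x)
  have h3 := notMem_of_rim_le μ (r := rim μ x - x) (c := rim μ x) (x := x)
    (by have := le_rim μ x; omega) (rim_nonneg μ x) (by ring) le_rfl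
  have h4 := aux (T x) (h0 x) (h1 x)
  by_contra hne
  have h5 : T x < rim μ x := by
    by_contra h6
    exact h3 (h2.2 (by omega))
  have h7 := mem_of_lt_rim μ (r := T x - x) (c := T x) (x := x) (by have := h1 x; omega)
    (h0 x) (by ring) h5
  exact lt_irrefl _ (h4.1 h7)

theorem rim_of_le {x : ℤ} (h : x ≤ -(μ.colLen 0 : ℤ)) : rim μ x = 0 := by
  by_contra hne
  have h0 := rim_nonneg μ x
  have h1 := mem_of_lt_rim μ (r := -x) (c := 0) (x := x) (by omega) le_rfl (by ring) (by omega)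
  have h2 := YoungDiagram.mem_iff_lt_colLen.1 h1
  rw [Int.toNat_zero] at h2
  omega

theorem rim_of_ge {x : ℤ} (h : (μ.rowLen 0 : ℤ) ≤ x) : rim μ x = x := by
  by_contra hne
  have h0 := le_rim μ x
  have h1 := mem_of_lt_rim μ (r := 0) (c := x) (x := x) le_rfl (by omega) (by ring) (by omega)
  have h2 := YoungDiagram.mem_iff_lt_rowLen.1 h1
  rw [Int.toNat_zero] at h2
  omega

end Rim

/-! ### Addable and removable nodes read off the rim -/

section Corners

variable (μ : YoungDiagram)

theorem isRemovable_iff (r c : ℕ) :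
    IsRemovable μ (r, c) ↔ (r, c) ∈ μ ∧ (r + 1, c) ∉ μ ∧ (r, c + 1) ∉ μ := by
  constructor
  · rintro ⟨h, ν, hν⟩
    have key : ∀ x : Node, x ∈ ν ↔ x ≠ (r, c) ∧ x ∈ μ := by
      intro x
      rw [← YoungDiagram.mem_cells, hν, Finset.mem_erase, YoungDiagram.mem_cells]
    have hn : (r, c) ∉ ν := fun h => ((key _).1 h).1 rfl
    refine ⟨h, fun h1 => hn ?_, fun h1 => hn ?_⟩
    · exact ν.up_left_mem (Nat.le_succ r) le_rfl ((key _).2 ⟨by simp, h1⟩)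
    · exact ν.up_left_mem le_rfl (Nat.le_succ c) ((key _).2 ⟨by simp, h1⟩)
  · rintro ⟨h, h1, h2⟩
    refine ⟨h, ⟨μ.cells.erase (r, c), ?_⟩, rfl⟩
    rintro ⟨a, b⟩ ⟨a', b'⟩ ⟨hle1, hle2⟩ hab
    simp only [Finset.coe_erase, Set.mem_sdiff, Finset.mem_coe, YoungDiagram.mem_cells,
      Set.mem_singleton_iff, Prod.mk.injEq] at hab ⊢
    refine ⟨μ.up_left_mem hle1 hle2 hab.1, ?_⟩
    rintro ⟨rfl, rfl⟩
    simp only at hle1 hle2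
    rcases hle1.lt_or_eq with h3 | h3
    · exact h1 (μ.up_left_mem h3 hle2 hab.1)
    rcases hle2.lt_or_eq with h4 | h4
    · exact h2 (μ.up_left_mem hle1 h4 hab.1)
    exact hab.2 ⟨h3.symm, h4.symm⟩

theorem isAddable_iff (r c : ℕ) :
    IsAddable μ (r, c) ↔ (r, c) ∉ μ ∧ (∀ s, r = s + 1 → (s, c) ∈ μ) ∧
      (∀ d, c = d + 1 → (r, d) ∈ μ) := by
  constructor
  · rintro ⟨h, ν, hν⟩
    have key : ∀ x : Node, x ∈ ν ↔ x = (r, c) ∨ x ∈ μ := by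
      intro x
      rw [← YoungDiagram.mem_cells, hν, Finset.mem_insert, YoungDiagram.mem_cells]
    have hn : (r, c) ∈ ν := (key _).2 (Or.inl rfl)
    refine ⟨h, fun s hs => ?_, fun d hd => ?_⟩
    · refine ((key (s, c)).1 (ν.up_left_mem (by omega) le_rfl hn)).resolve_left ?_
      simp only [Prod.mk.injEq]
      omega
    · refine ((key (r, d)).1 (ν.up_left_mem le_rfl (by omega) hn)).resolve_left ?_
      simp only [Prod.mk.injEq]
      omega
  · rintro ⟨h, h1, h2⟩
    refine ⟨h, ⟨insert (r, c) μ.cells, ?_⟩, rfl⟩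
    rintro ⟨a, b⟩ ⟨a', b'⟩ ⟨hle1, hle2⟩ hab
    simp only [Finset.coe_insert, Set.mem_insert_iff, Finset.mem_coe, YoungDiagram.mem_cells,
      Prod.mk.injEq] at hab ⊢
    simp only at hle1 hle2
    rcases hab with ⟨rfl, rfl⟩ | hab
    · rcases hle1.lt_or_eq with h3 | h3
      · right
        obtain ⟨s, rfl⟩ : ∃ s, a = s + 1 := ⟨a - 1, by omega⟩
        exact μ.up_left_mem (by omega) hle2 (h1 s rfl)
      rcases hle2.lt_or_eq with h4 | h4
      · right
        obtain ⟨s, rfl⟩ : ∃ s, b = s + 1 := ⟨b - 1, by omega⟩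
        exact μ.up_left_mem hle1 (by omega) (h2 s rfl)
      exact Or.inl ⟨h3, h4⟩
    · exact Or.inr (μ.up_left_mem hle1 hle2 hab)

theorem isRemovable_iff_rim (x : Node) :
    IsRemovable μ x ↔ rim μ (content x) = x.2 + 1 ∧ rim μ (content x - 1) = x.2 ∧
      rim μ (content x + 1) = x.2 + 1 := by
  obtain ⟨r, c⟩ := x
  rw [isRemovable_iff, mem_iff_lt_rim, mem_iff_lt_rim, mem_iff_lt_rim]
  have h1 := rim_succ_le μ ((c : ℤ) - r - 1)
  have h2 := rim_le_rim_succ μ ((c : ℤ) - r)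
  simp only [content, Nat.cast_add, Nat.cast_one, sub_add_cancel] at *
  rw [show (c : ℤ) - (r + 1) = c - r - 1 by ring, show (c : ℤ) + 1 - r = c - r + 1 by ring]
  omega

theorem isAddable_iff_rim (x : Node) :
    IsAddable μ x ↔ rim μ (content x) = x.2 ∧ rim μ (content x - 1) = x.2 ∧
      rim μ (content x + 1) = x.2 + 1 := by
  obtain ⟨r, c⟩ := x
  rw [isAddable_iff]
  have h1 := rim_le_rim_succ μ ((c : ℤ) - r - 1)
  have h2 := rim_succ_le μ ((c : ℤ) - r)
  have h3 := mem_iff_lt_rim μ r c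
  simp only [content, sub_add_cancel] at *
  have h4 : (∀ s, r = s + 1 → (s, c) ∈ μ) ↔ (c : ℤ) < rim μ (c - r + 1) := by
    rcases r with _ | s
    · have := le_rim μ ((c : ℤ) - 0 + 1)
      simp only [Nat.cast_zero]
      constructor
      · intro; omega
      · intros; omega
    · rw [show (c : ℤ) - (s + 1 : ℕ) + 1 = c - s by push_cast; ring, ← mem_iff_lt_rim]
      simp
  have h5 : (∀ d, c = d + 1 → (r, d) ∈ μ) ↔ (c : ℤ) ≤ rim μ (c - r - 1) := by
    rcases c with _ | d
    · have := rim_nonneg μ ((0 : ℤ) - r - 1)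
      simpa using this
    · rw [show ((d + 1 : ℕ) : ℤ) - r - 1 = d - r by push_cast; ring]
      have := mem_iff_lt_rim μ r d
      simp only [Nat.add_right_cancel_iff, forall_eq', this]
      omega
  rw [h4, h5, h3]
  omega

theorem isRemovable_of_rim {p : ℤ} (h1 : rim μ (p - 1) = rim μ p - 1)
    (h2 : rim μ (p + 1) = rim μ p) :
    ∃ x : Node, content x = p ∧ (x.2 : ℤ) = rim μ p - 1 ∧ IsRemovable μ x := by
  have h3 := le_rim μ (p + 1)
  have h4 := rim_nonneg μ (p - 1)
  have hc : content ((rim μ p - 1 - p).toNat, (rim μ p - 1).toNat) = p := by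
    simp only [content]; omega
  refine ⟨_, hc, by simp only; omega, ?_⟩
  rw [isRemovable_iff_rim, hc]
  simp only
  omega

theorem isAddable_of_rim {p : ℤ} (h1 : rim μ (p - 1) = rim μ p)
    (h2 : rim μ (p + 1) = rim μ p + 1) :
    ∃ x : Node, content x = p ∧ (x.2 : ℤ) = rim μ p ∧ IsAddable μ x := by
  have h3 := le_rim μ p
  have h4 := rim_nonneg μ p
  have hc : content ((rim μ p - p).toNat, (rim μ p).toNat) = p := by
    simp only [content]; omega
  refine ⟨_, hc, by simp only; omega, ?_⟩
  rw [isAddable_iff_rim, hc]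
  simp only
  omega

theorem exists_isRemovable (h : μ.cells.Nonempty) : ∃ x, IsRemovable μ x := by
  obtain ⟨⟨r, c⟩, hx, hmax⟩ := Finset.exists_max_image μ.cells (fun x => x.1 + x.2) h
  refine ⟨(r, c), (isRemovable_iff μ r c).2 ⟨hx, fun h1 => ?_, fun h1 => ?_⟩⟩
  · have := hmax _ ((YoungDiagram.mem_cells _).2 h1)
    simp only at this
    omega
  · have := hmax _ ((YoungDiagram.mem_cells _).2 h1)
    simp only at this
    omega

theorem rim_of_erase {μ ν : YoungDiagram} {x : Node} (hx : IsRemovable μ x)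
    (hν : ν.cells = μ.cells.erase x) (z : ℤ) :
    rim ν z = if z = content x then rim μ z - 1 else rim μ z := by
  have hx' := (isRemovable_iff_rim μ x).1 hx
  have hcx : content x = (x.2 : ℤ) - x.1 := rfl
  rw [rim_unique ν (fun z => if z = content x then rim μ z - 1 else rim μ z)]
  · intro z
    have := rim_nonneg μ z
    split_ifs with h
    · subst h; omega
    · exact this
  · intro z
    have := le_rim μ z
    split_ifs with h
    · subst h; omega
    · exact this
  · intro r c
    rw [← YoungDiagram.mem_cells, hν, Finset.mem_erase, YoungDiagram.mem_cells, mem_iff_lt_rim]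
    split_ifs with h
    · have : (r, c) ≠ x ↔ c ≠ x.2 := by
        constructor
        · intro h1 h2
          exact h1 (Prod.ext (by simp only; omega) h2)
        · rintro h1 rfl
          exact h1 rfl
      rw [this, h]
      omega
    · have : (r, c) ≠ x := by
        rintro rfl
        exact h rfl
      simp [this]

end Corners

/-! ### Hooks and regularity in terms of the rim -/

/-- Regularity of a partition in terms of its rim. -/
def RimRegular (e : ℕ) (A : ℕ → ℤ) (S : ℤ → ℤ) : Prop :=
  ∀ t w z : ℤ, 1 ≤ t → z = w + e * t →
    ¬ (S z - S w = extend A t + 1 ∧ S (z + 1) - S (w + 1) = extend A t)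

theorem rim_mono (μ : YoungDiagram) : Monotone (rim μ) :=
  monotone_int_of_le_succ (rim_le_rim_succ μ)

theorem rim_sub_le (μ : YoungDiagram) {x y : ℤ} (h : x ≤ y) : rim μ y - y ≤ rim μ x - x :=
  antitone_int_of_succ_le (f := fun x => rim μ x - x)
    (fun x => by have := rim_succ_le μ x; omega) h

/-- A hook at (r, c) corresponds to a pair w < z: z is the content of the last node of row r, and w
that of the first node below column c. Then z - w is the hook length, S w = c, and S z - S w - 1 is
the arm length; S rises after w and is flat after z. -/
theorem isRegular_iff_rimRegular {e : ℕ} (he : 0 < e) (A : ℕ → ℤ) (μ : YoungDiagram) :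
    IsRegular e A μ ↔ RimRegular e A (rim μ) := by
  constructor
  · rintro hreg t w z ht hz ⟨h1, h2⟩
    have hzw : w + 1 ≤ z := by nlinarith
    have hw := rim_succ_le μ w
    have hz' := rim_le_rim_succ μ z
    have hmono := rim_mono μ hzw
    have hlip := rim_sub_le μ (x := w) (y := z) (by omega)
    have hw0 := rim_nonneg μ w
    have hwle := le_rim μ w
    have hzle := le_rim μ (z + 1)
    have hin := mem_of_lt_rim μ (r := rim μ z - 1 - z) (c := rim μ z - 1) (x := z) (by omega)
      (by omega) (by ring) (by omega)
    have hout := notMem_of_rim_le μ (r := rim μ z - 1 - z) (c := rim μ z) (x := z + 1) (by omega)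
      (by omega) (by ring) (by omega)
    have hin' := mem_of_lt_rim μ (r := rim μ w - w - 1) (c := rim μ w) (x := w + 1) (by omega)
      (by omega) (by ring) (by omega)
    have hout' := notMem_of_rim_le μ (r := rim μ w - w) (c := rim μ w) (x := w) (by omega)
      (by omega) (by ring) (by omega)
    have hrow : (μ.rowLen (rim μ z - 1 - z).toNat : ℤ) = rim μ z := by
      rw [YoungDiagram.mem_iff_lt_rowLen] at hin hout
      omega
    have hcol : (μ.colLen (rim μ w).toNat : ℤ) = rim μ w - w := by
      rw [YoungDiagram.mem_iff_lt_colLen] at hin' hout'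
      omega
    lift t to ℕ using (by omega)
    rw [extend_natCast] at h1 h2
    refine hreg ((rim μ z - 1 - z).toNat, (rim μ w).toNat)
      (μ.up_left_mem le_rfl (by omega) hin) t (by omega) ⟨?_, ?_⟩
    · simp only [hookLength, armLength, legLength]
      zify
      omega
    · simp only [armLength]
      omega
  · rintro hreg ⟨r, c⟩ hx t ht ⟨h1, h2⟩
    have hr := YoungDiagram.mem_iff_lt_rowLen.1 hx
    have hc := YoungDiagram.mem_iff_lt_colLen.1 hx
    simp only [hookLength, armLength, legLength] at h1 h2
    have a1 := (mem_iff_lt_rim μ r (μ.rowLen r - 1)).1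
      (YoungDiagram.mem_iff_lt_rowLen.2 (by omega))
    have a2 := (mem_iff_lt_rim μ r (μ.rowLen r)).not.1
      (YoungDiagram.mem_iff_lt_rowLen.not.2 (by omega))
    have a3 := (mem_iff_lt_rim μ (μ.colLen c - 1) c).1
      (YoungDiagram.mem_iff_lt_colLen.2 (by omega))
    have a4 := (mem_iff_lt_rim μ (μ.colLen c) c).not.1
      (YoungDiagram.mem_iff_lt_colLen.not.2 (by omega))
    rw [show ((μ.rowLen r - 1 : ℕ) : ℤ) - r = μ.rowLen r - 1 - r by omega] at a1
    rw [show (μ.rowLen r : ℤ) - r = μ.rowLen r - 1 - r + 1 by omega] at a2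
    rw [show (c : ℤ) - (μ.colLen c - 1 : ℕ) = c - μ.colLen c + 1 by omega] at a3
    have b1 := rim_le_rim_succ μ (μ.rowLen r - 1 - r)
    have b2 := rim_succ_le μ (c - μ.colLen c)
    refine hreg t (c - μ.colLen c) (μ.rowLen r - 1 - r) (by omega) ?_ ⟨?_, ?_⟩
    · zify at h1
      omega
    · rw [extend_natCast]
      omega
    · rw [extend_natCast]
      omega

/-! ### The telescoping sum of curvatures -/

section Balance

variable {e : ℕ} {A : ℕ → ℤ} {S : ℤ → ℤ}

/-- The second difference of `S`; for a rim it is `1` at the content of an addable node, `-1` at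
the content of a removable node and `0` elsewhere. -/
def curvature (S : ℤ → ℤ) (x : ℤ) : ℤ := S (x + 1) - 2 * S x + S (x - 1)

/-- If `y + e t` is larger than `y`, the number of beads at `y + e t`, decreased by `1` when
`t < 0`. -/
def tailTerm (e : ℕ) (A : ℕ → ℤ) (S : ℤ → ℤ) (t y : ℤ) : ℤ :=
  if extend A t < S (y + e * t) - S y then
    1 - (S (y + e * t + 1) - S (y + e * t)) - (if t < 0 then 1 else 0) else 0

/-- While the inequality holds at both y - 1 and y, this is the definition of curvature. If it
changes, regularity allows only entry for t > 0, forcing the step of S just before y + et to be 1,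
and only exit for t < 0, forcing that step to be 0. The correction for t < 0 makes both boundary
cases come out right. -/
theorem tailTerm_sub (hA : IsArmSequence e A) (hS0 : ∀ x, S x ≤ S (x + 1))
    (hS1 : ∀ x, S (x + 1) ≤ S x + 1) (hreg : RimRegular e A S) (t y : ℤ) :
    tailTerm e A S t (y - 1) - tailTerm e A S t y =
      if extend A t < S (y + e * t) - S y then curvature S (y + e * t) else 0 := by
  have h1 : y - 1 + e * t = y + e * t - 1 := by ring
  have hpos := fun h => hreg t (y - 1) (y + e * t - 1) h (by ring)
  have hneg := fun h => hreg (-t) (y + e * t - 1) (y - 1) h (by ring)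
  have hopp := fun h => extend_neg A (t := -t) h
  have a1 := hS0 (y - 1)
  have a2 := hS1 (y - 1)
  have a3 := hS0 (y + e * t - 1)
  have a4 := hS1 (y + e * t - 1)
  rw [neg_neg] at hopp
  simp only [tailTerm, curvature, h1, sub_add_cancel] at *
  generalize hz : y + e * t = z at *
  rcases lt_trichotomy t 0 with ht | rfl | ht
  · have := hneg (by omega)
    have := hopp (by omega)
    split_ifs <;> omega
  · have : z = y := by simp [← hz]
    subst this
    simp [hA.extend_zero]
  · have := hpos (by omega)
    split_ifs <;> omega

variable {M : ℤ}

/-- For t ≥ 1, the bound t - 1 ≤ A_t forces S(y + et) ≥ t. If y + et < M this gives t ≤ M, which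
puts y + et back in the region where S vanishes. -/
theorem tailTerm_eq_zero_of_le (hA : IsArmSequence e A) (hS0 : ∀ x, S x ≤ S (x + 1))
    (hlow : ∀ x ≤ -M, S x = 0) (hhigh : ∀ x, M ≤ x → S x = x) (hM : 0 ≤ M) {y : ℤ}
    (hy : y ≤ -(M + e * M)) (t : ℤ) : tailTerm e A S t y = 0 := by
  have hmono : Monotone S := monotone_int_of_le_succ hS0
  have heM : 0 ≤ (e : ℤ) * M := by positivity
  have hSy := hlow y (by omega)
  simp only [tailTerm]
  split_ifs with h1 h2
  · have : (e : ℤ) * t ≤ 0 := mul_nonpos_of_nonneg_of_nonpos (by omega) h2.le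
    rcases eq_or_lt_of_le this with h4 | h4
    · rw [h4] at h1 ⊢
      by_cases hy' : y + 0 + 1 ≤ -M
      · rw [hlow _ hy', hlow _ (by omega)]; rfl
      · have hle := hA.le_extend (t := -t) (by omega)
        rcases mul_eq_zero.1 h4 with h5 | h5
        · have hup := hA.extend_le (t := -t) (by omega)
          rw [h5] at hup
          omega
        · omega
    · rw [hlow _ (by omega), hlow _ (by omega)]; rfl
  · rcases (not_lt.1 h2).eq_or_lt with rfl | ht
    · rw [hA.extend_zero, mul_zero, add_zero] at h1
      omega
    · have hle := hA.le_extend (t := t) (by omega)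
      by_cases hx : M ≤ y + e * t
      · rw [hhigh _ hx, hhigh _ (by omega)]; ring
      · have := hmono (not_le.1 hx).le
        rw [hhigh M le_rfl] at this
        have h5 : (e : ℤ) * t ≤ e * M := mul_le_mul_of_nonneg_left (by omega) (by omega)
        have := hlow (y + e * t) (by omega)
        omega
  · rfl

/-- The mirror image, resting on A_t ≤ (e - 1)t: for negative t the inequality can hold only once y
+ et has left the region where S is the identity, and by then it lies where S is zero. -/
theorem tailTerm_eq_zero_of_ge (hA : IsArmSequence e A)
    (hS1 : ∀ x, S (x + 1) ≤ S x + 1) (hlow : ∀ x ≤ -M, S x = 0)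
    (hhigh : ∀ x, M ≤ x → S x = x) (hM : 0 ≤ M) {y : ℤ}
    (hy : M + e * M ≤ y) (t : ℤ) : tailTerm e A S t y = 0 := by
  have hanti : Antitone fun x => S x - x :=
    antitone_int_of_succ_le (fun x => by have := hS1 x; omega)
  have heM : 0 ≤ (e : ℤ) * M := by positivity
  have hSy := hhigh y (by omega)
  simp only [tailTerm]
  split_ifs with h1 h2
  · have hle := hA.extend_le (t := -t) (by omega)
    have hopp := extend_neg A (t := -t) (by omega)
    rw [neg_neg] at hopp
    have hle' : extend A (-t) ≤ -(e * t) + t := by linarith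
    by_cases hx : y + e * t + 1 ≤ -M
    · rw [hlow _ hx, hlow _ (by omega)]; rfl
    · by_cases hx' : M ≤ y + e * t
      · have := hhigh _ hx'
        omega
      · exfalso
        have h3 : S (y + e * t) - (y + e * t) ≤ M := by
          by_cases h4 : -M ≤ y + e * t
          · have := hanti h4
            have := hlow (-M) le_rfl
            simp only at *
            omega
          · have := hlow (y + e * t) (by omega)
            omega
        have h5 : (e : ℤ) * (-t) ≤ e * M := mul_le_mul_of_nonneg_left (by omega) (by omega)
        rw [mul_neg] at h5
        omega
  · have : (0 : ℤ) ≤ e * t := mul_nonneg (by omega) (by omega)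
    rw [hhigh _ (by omega), hhigh _ (by omega)]
    ring
  · rfl

theorem sum_curvature_eq_zero (hA : IsArmSequence e A) (hS0 : ∀ x, S x ≤ S (x + 1))
    (hS1 : ∀ x, S (x + 1) ≤ S x + 1) (hreg : RimRegular e A S)
    (hlow : ∀ x ≤ -M, S x = 0) (hhigh : ∀ x, M ≤ x → S x = x) (hM : 0 ≤ M)
    {N : ℕ} (hN : M + e * M ≤ N) (T : Finset ℤ) :
    ∑ k ∈ Finset.range (2 * N), ∑ t ∈ T,
      (if extend A t < S (-(N : ℤ) + (k + 1 : ℕ) + e * t) - S (-(N : ℤ) + (k + 1 : ℕ)) then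
        curvature S (-(N : ℤ) + (k + 1 : ℕ) + e * t) else 0) = 0 := by
  rw [Finset.sum_comm]
  refine Finset.sum_eq_zero fun t _ => ?_
  calc _ = ∑ k ∈ Finset.range (2 * N), (tailTerm e A S t (-(N : ℤ) + (k : ℕ)) -
          tailTerm e A S t (-(N : ℤ) + (k + 1 : ℕ))) := by
        refine Finset.sum_congr rfl fun k _ => ?_
        rw [← tailTerm_sub hA hS0 hS1 hreg]
        congr 2
        push_cast
        ring
    _ = 0 := by
        rw [Finset.sum_range_sub' (fun k => tailTerm e A S t (-(N : ℤ) + (k : ℕ))),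
          tailTerm_eq_zero_of_le hA hS0 hlow hhigh hM (by push_cast; omega),
          tailTerm_eq_zero_of_ge hA hS1 hlow hhigh hM (by push_cast; omega), sub_zero]

end Balance

/-! ### Cancellation in sign sequences -/

/-- The weight of a signature: the number of entries `+` minus the number of entries `-`. -/
def weight : List (Sign × Node) → ℤ
  | [] => 0
  | (Sign.plus, _) :: l => weight l + 1
  | (Sign.minus, _) :: l => weight l - 1

section Lists

open List

theorem weight_append (l l' : List (Sign × Node)) : weight (l ++ l') = weight l + weight l' := by
  induction l with
  | nil => simp [weight]
  | cons a l ih =>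
    obtain ⟨_ | _, x⟩ := a <;> simp only [cons_append, weight, ih] <;> ring

/-- The chosen entry is the last uncancelled -: each + before it is cancelled before reaching it,
and each - after it is cancelled by a + also after it. It heads the shortest tail of the list that
still has a prefix of negative weight. -/
theorem exists_split_of_weight_neg (l : List (Sign × Node))
    (h : ∃ q, q <+: l ∧ weight q < 0) :
    ∃ l₁ x l₂, l = l₁ ++ (Sign.minus, x) :: l₂ ∧ (∀ s, s <:+ l₁ → weight s ≤ 0) ∧
      ∀ q, q <+: l₂ → 0 ≤ weight q := by
  induction l with
  | nil =>
    obtain ⟨q, hq, hw⟩ := h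
    rw [prefix_nil.1 hq] at hw
    exact absurd hw (lt_irrefl _)
  | cons a l ih =>
    by_cases hl : ∃ q, q <+: l ∧ weight q < 0
    · obtain ⟨l₁, x, l₂, rfl, h1, h2⟩ := ih hl
      refine ⟨a :: l₁, x, l₂, rfl, fun s hs => ?_, h2⟩
      rcases suffix_cons_iff.1 hs with rfl | hs
      swap
      · exact h1 s hs
      have hw₁ := h1 l₁ (suffix_refl _)
      obtain ⟨_ | _, y⟩ := a
      -- Only the suffix consisting of all of `a :: l₁` is new. A negative prefix `q` either stops
      -- inside `l₁`, and what is left of `l₁` has weight at most 0, or runs past `x` into `l₂`,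
      -- which contributes at least 0.
      · obtain ⟨q, hq, hw⟩ := h
        simp only [weight]
        rcases prefix_cons_iff.1 hq with rfl | ⟨q', rfl, hq'⟩
        · exact absurd hw (lt_irrefl _)
        simp only [weight] at hw
        obtain ⟨u, hu⟩ := hq'
        rcases append_eq_append_iff.1 hu with ⟨s, rfl, -⟩ | ⟨s, rfl, hs⟩
        · have := h1 s (suffix_append _ _)
          rw [weight_append]
          omega
        · rcases prefix_cons_iff.1 ⟨u, hs.symm⟩ with rfl | ⟨s', rfl, hs'⟩
          · rw [append_nil] at hw
            omega
          · have := h2 s' hs'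
            rw [weight_append] at hw
            simp only [weight] at hw
            omega
      · simp only [weight]
        omega
    · push Not at hl
      obtain ⟨_ | _, y⟩ := a
      · obtain ⟨q, hq, hw⟩ := h
        rcases prefix_cons_iff.1 hq with rfl | ⟨q', rfl, hq'⟩
        · exact absurd hw (lt_irrefl _)
        · have := hl q' hq'
          simp only [weight] at hw
          omega
      · exact ⟨[], y, l, rfl, fun s hs => by rw [suffix_nil.1 hs]; exact le_rfl, hl⟩

/-- The uncancelled - signs are counted by how far prefix weights dip below zero. A leading + raises
the permitted depth for the tail by one, a leading - lowers it. -/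
theorem reduction_eq_append (l : List (Sign × Node)) (k : ℕ)
    (h : ∀ q, q <+: l → -(k : ℤ) ≤ weight q) :
    ∃ ms ps : List (Sign × Node), reduction l = ms ++ ps ∧ (∀ a ∈ ms, a.1 = Sign.minus) ∧
      (∀ a ∈ ps, a.1 = Sign.plus) ∧ ms.length ≤ k := by
  induction l generalizing k with
  | nil => exact ⟨[], [], rfl, by simp, by simp, by simp⟩
  | cons a l ih =>
    obtain ⟨_ | _, y⟩ := a
    · obtain ⟨ms, ps, hr, hms, hps, hk⟩ := ih (k + 1) fun q hq => by
        have := h ((Sign.plus, y) :: q) ((prefix_cons_inj _).2 hq)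
        simp only [weight] at this
        push_cast
        omega
      change ∃ ms' ps', consReduce (Sign.plus, y) (reduction l) = ms' ++ ps' ∧ _
      rw [hr]
      rcases ms with _ | ⟨⟨_ | _, z⟩, ms⟩
      · refine ⟨[], (Sign.plus, y) :: ps, ?_, by simp, ?_, by simp⟩
        · rcases ps with _ | ⟨⟨_ | _, z⟩, ps⟩
          · rfl
          · rfl
          · simpa using hps (Sign.minus, z) (by simp)
        · rintro b (_ | ⟨_, hb⟩)
          · rfl
          · exact hps b hb
      · simpa using hms (Sign.plus, z) (by simp)
      · exact ⟨ms, ps, rfl, fun b hb => hms b (mem_cons_of_mem _ hb), hps, by simpa using hk⟩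
    · have h0 := h [(Sign.minus, y)] ((prefix_cons_inj _).2 nil_prefix)
      simp only [weight] at h0
      obtain ⟨k, rfl⟩ : ∃ j, k = j + 1 := ⟨k - 1, by omega⟩
      obtain ⟨ms, ps, hr, hms, hps, hk⟩ := ih k fun q hq => by
        have := h ((Sign.minus, y) :: q) ((prefix_cons_inj _).2 hq)
        simp only [weight] at this
        push_cast at this
        omega
      refine ⟨(Sign.minus, y) :: ms, ps, ?_, ?_, hps, by simpa using hk⟩
      · change consReduce (Sign.minus, y) (reduction l) = _
        rw [hr]
        rfl
      · rintro b (_ | ⟨_, hb⟩)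
        · rfl
        · exact hms b hb

/-- Read from the right, each + of `l` finds a pending - to cancel, so `x` keeps its place as first
+. The exact length of `ms` is what lets the induction exclude a + meeting no -. -/
theorem foldr_consReduce_eq_append (l ps : List (Sign × Node)) (x : Node)
    (h : ∀ s, s <:+ l → weight s ≤ 0) :
    ∃ ms : List (Sign × Node), l.foldr consReduce ((Sign.plus, x) :: ps) =
      ms ++ (Sign.plus, x) :: ps ∧ (∀ a ∈ ms, a.1 = Sign.minus) ∧
        (ms.length : ℤ) = -weight l := by
  induction l with
  | nil => exact ⟨[], rfl, by simp, rfl⟩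
  | cons a l ih =>
    obtain ⟨ms, hr, hms, hlen⟩ := ih fun s hs => h s (hs.trans (suffix_cons _ _))
    have h0 := h _ (suffix_refl _)
    rw [foldr_cons, hr]
    obtain ⟨_ | _, y⟩ := a
    · rcases ms with _ | ⟨⟨_ | _, z⟩, ms⟩
      · simp only [weight, length_nil, Nat.cast_zero] at *
        omega
      · simpa using hms (Sign.plus, z) (by simp)
      · refine ⟨ms, rfl, fun b hb => hms b (mem_cons_of_mem _ hb), ?_⟩
        simp only [weight, length_cons] at *
        push_cast at hlen
        omega
    · refine ⟨(Sign.minus, y) :: ms, rfl, ?_, ?_⟩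
      · rintro b (_ | ⟨_, hb⟩)
        · rfl
        · exact hms b hb
      · simp only [weight, length_cons] at *
        push_cast
        omega

theorem plusNodes_append (ms l : List (Sign × Node)) (h : ∀ a ∈ ms, a.1 = Sign.minus) :
    plusNodes (ms ++ l) = plusNodes l := by
  induction ms with
  | nil => rfl
  | cons a ms ih =>
    obtain ⟨_ | _, y⟩ := a
    · simpa using h (Sign.plus, y) (by simp)
    · exact ih fun b hb => h b (mem_cons_of_mem _ hb)

theorem head?_plusNodes_reduction (l₁ l₂ : List (Sign × Node)) (x : Node)
    (h₁ : ∀ s, s <:+ l₁ → weight s ≤ 0) (h₂ : ∀ q, q <+: l₂ → 0 ≤ weight q) :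
    (plusNodes (reduction (l₁ ++ (Sign.plus, x) :: l₂))).head? = some x := by
  obtain ⟨ms, ps, hr, -, hps, hlen⟩ := reduction_eq_append l₂ 0 (by simpa using h₂)
  rw [Nat.le_zero, length_eq_zero_iff] at hlen
  subst hlen
  have h3 : reduction ((Sign.plus, x) :: l₂) = (Sign.plus, x) :: ps := by
    change consReduce (Sign.plus, x) (reduction l₂) = _
    rw [hr]
    rcases ps with _ | ⟨⟨_ | _, z⟩, ps⟩
    · rfl
    · rfl
    · simpa using hps (Sign.minus, z) (by simp)
  obtain ⟨ms, hr', hms, -⟩ := foldr_consReduce_eq_append l₁ ps x h₁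
  have h4 : reduction (l₁ ++ (Sign.plus, x) :: l₂) = ms ++ (Sign.plus, x) :: ps := by
    rw [← hr', ← h3]
    exact foldr_append
  rw [h4, plusNodes_append _ _ hms]
  rfl

theorem filter_prefix_of_pairwise {α : Type*} {R : α → α → Prop} {l : List α}
    (hl : l.Pairwise R) (p : α → Bool)
    (hp : ∀ a ∈ l, ∀ b ∈ l, R a b → p b = true → p a = true) :
    l.filter p <+: l := by
  induction l with
  | nil => exact prefix_refl _
  | cons a l ih =>
    rw [pairwise_cons] at hl
    by_cases ha : p a = true
    · rw [filter_cons_of_pos ha, prefix_cons_inj]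
      exact ih hl.2 fun b hb c hc =>
        hp b (mem_cons_of_mem _ hb) c (mem_cons_of_mem _ hc)
    · have : (a :: l).filter p = [] := by
        rw [filter_eq_nil_iff]
        rintro b (_ | ⟨_, hb⟩) hpb
        · exact ha hpb
        · exact ha (hp a mem_cons_self b (mem_cons_of_mem _ hb) (hl.1 b hb) hpb)
      rw [this]
      exact nil_prefix

end Lists

/-! ### Signatures of regular partitions and their good nodes -/

section Signature

variable {e : ℕ} {A : ℕ → ℤ} {μ ν : YoungDiagram} {i : ZMod e}

open Classical in
/-- The addable and removable `i`-nodes of `μ` in decreasing order. -/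
noncomputable def sortedNodes (e : ℕ) (A : ℕ → ℤ) (i : ZMod e) (μ : YoungDiagram) : List Node :=
  (signatureNodes e i μ).toList.mergeSort fun x y => decide (x = y ∨ NodeLT e A y x)

open Classical in
/-- A node together with its sign in the signature of `μ`. -/
noncomputable def signed (μ : YoungDiagram) (x : Node) : Sign × Node :=
  (if IsAddable μ x then Sign.plus else Sign.minus, x)

theorem signature_eq_map : signature e A i μ = (sortedNodes e A i μ).map (signed μ) := rfl

theorem signed_of_isAddable {x : Node} (h : IsAddable μ x) : signed μ x = (Sign.plus, x) := by
  simp [signed, h]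

theorem signed_of_not_isAddable {x : Node} (h : ¬ IsAddable μ x) :
    signed μ x = (Sign.minus, x) := by
  simp [signed, h]

theorem signed_of_isRemovable {x : Node} (h : IsRemovable μ x) :
    signed μ x = (Sign.minus, x) :=
  signed_of_not_isAddable fun h' => h'.1 h.1

theorem colLen_le_card (c : ℕ) : μ.colLen c ≤ μ.card := by
  rw [YoungDiagram.colLen_eq_card]
  exact Finset.card_le_card (Finset.filter_subset _ _)

theorem rowLen_le_card (r : ℕ) : μ.rowLen r ≤ μ.card := by
  rw [YoungDiagram.rowLen_eq_card]
  exact Finset.card_le_card (Finset.filter_subset _ _)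

theorem mem_signatureNodes {x : Node} :
    x ∈ signatureNodes e i μ ↔ residue e x = i ∧ (IsAddable μ x ∨ IsRemovable μ x) := by
  simp only [signatureNodes, Finset.mem_filter, Finset.mem_product, Finset.mem_range,
    and_iff_right_iff_imp]
  rintro ⟨-, h⟩
  obtain ⟨r, c⟩ := x
  have hr := fun s => colLen_le_card (μ := μ) s
  have hc := fun s => rowLen_le_card (μ := μ) s
  rcases h with h | h
  · rw [isAddable_iff] at h
    constructor
    · rcases r with _ | s
      · exact Nat.succ_pos _
      · have := YoungDiagram.mem_iff_lt_colLen.1 (h.2.1 s rfl)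
        have := hr c
        simp only
        omega
    · rcases c with _ | s
      · exact Nat.succ_pos _
      · have := YoungDiagram.mem_iff_lt_rowLen.1 (h.2.2 s rfl)
        have := hc r
        simp only
        omega
  · have h1 := YoungDiagram.mem_iff_lt_colLen.1 h.1
    have h2 := YoungDiagram.mem_iff_lt_rowLen.1 h.1
    have := hr c
    have := hc r
    simp only
    omega

theorem mem_sortedNodes {x : Node} :
    x ∈ sortedNodes e A i μ ↔ residue e x = i ∧ (IsAddable μ x ∨ IsRemovable μ x) := by
  rw [sortedNodes, List.mem_mergeSort, Finset.mem_toList, mem_signatureNodes]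

theorem nodup_sortedNodes : (sortedNodes e A i μ).Nodup :=
  (List.mergeSort_perm _ _).nodup_iff.2 (Finset.nodup_toList _)

theorem pairwise_sortedNodes (he : 0 < e) (hA : IsArmSequence e A) :
    (sortedNodes e A i μ).Pairwise fun x y => NodeLT e A y x := by
  classical
  have hle : (sortedNodes e A i μ).Pairwise fun x y => x = y ∨ NodeLT e A y x := by
    -- The sorting theorem needs a total comparison, and the order is total only within one residue
    -- class.
    let P := {x : Node // residue e x = i}
    let l : List P := (signatureNodes e i μ).toList.attachWith (fun x => residue e x = i)
      fun x hx => (mem_signatureNodes.1 (Finset.mem_toList.1 hx)).1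
    let s : P → P → Bool := fun x y => decide (x.1 = y.1 ∨ NodeLT e A y.1 x.1)
    have hl : l.map Subtype.val = (signatureNodes e i μ).toList :=
      List.attachWith_map_subtype_val _
    have hmap : (l.mergeSort s).map Subtype.val = sortedNodes e A i μ := by
      rw [sortedNodes, ← hl]
      exact List.map_mergeSort fun _ _ _ _ => rfl
    have hsort := List.pairwise_mergeSort (le := s)
      (fun a b c hab hbc => by
        simp only [s, decide_eq_true_eq] at hab hbc ⊢
        rcases hab with h1 | h1
        · rw [h1]; exact hbc
        · rcases hbc with h2 | h2
          · rw [← h2]; exact Or.inr h1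
          · exact Or.inr (NodeLT.trans he hA h2 h1))
      (fun a b => by
        simp only [s, Bool.or_eq_true, decide_eq_true_eq]
        rcases nodeLT_total he hA (a.2.trans b.2.symm) with h | h | h
        · exact Or.inl (Or.inl h)
        · exact Or.inr (Or.inr h)
        · exact Or.inl (Or.inr h)) l
    rw [← hmap, List.pairwise_map]
    exact hsort.imp fun h => by simpa [s] using h
  exact (hle.and nodup_sortedNodes).imp fun h => h.1.resolve_left h.2

theorem eq_of_content_eq {x y : Node} (hx : IsAddable μ x ∨ IsRemovable μ x)
    (hy : IsAddable μ y ∨ IsRemovable μ y) (h : content x = content y) : x = y := by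
  rw [isAddable_iff_rim, isRemovable_iff_rim] at hx hy
  rw [h] at hx
  simp only [content] at h hx hy
  ext <;> omega

/-- The rim exceeds the column by 1 at a removable node and equals it at an addable one, so the
inequality could fail only for x removable and y addable, right at the threshold; that configuration
is a forbidden hook. Thus nodes can be compared with arbitrary contents through the rim alone. -/
theorem NodeLT.rim_lt (he : 0 < e) (hA : IsArmSequence e A) (hreg : RimRegular e A (rim μ))
    {x y : Node} (hx : IsAddable μ x ∨ IsRemovable μ x) (hy : IsAddable μ y ∨ IsRemovable μ y)
    (h : NodeLT e A x y) : ∃ t : ℤ, content y = content x + e * t ∧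
      extend A t < rim μ (content y) - rim μ (content x) := by
  obtain ⟨t, h1, h2⟩ := (nodeLT_iff he hA x y).1 h
  refine ⟨t, h1, ?_⟩
  rw [isAddable_iff_rim, isRemovable_iff_rim] at hx hy
  have hpos := fun h => hreg t (content x - 1) (content y - 1) h (by rw [h1]; ring)
  have hneg := fun h => hreg (-t) (content y) (content x) h (by rw [h1]; ring)
  have hopp := fun h => extend_neg A (t := -t) h
  rw [neg_neg] at hopp
  simp only [sub_add_cancel] at hpos
  rcases lt_trichotomy t 0 with ht | rfl | ht
  · have := hneg (by omega)
    have := hopp (by omega)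
    omega
  · rw [mul_zero, add_zero] at h1
    rw [h1] at hy ⊢
    rw [hA.extend_zero] at *
    omega
  · have := hpos (by omega)
    omega

theorem weight_map_signed {l : List Node} (h : ∀ x ∈ l, IsAddable μ x ∨ IsRemovable μ x) :
    weight (l.map (signed μ)) = (l.map fun x => curvature (rim μ) (content x)).sum := by
  induction l with
  | nil => rfl
  | cons x l ih =>
    rw [List.map_cons, List.map_cons, List.sum_cons,
      ← ih fun y hy => h y (List.mem_cons_of_mem _ hy)]
    rcases h x List.mem_cons_self with hx | hx
    · rw [signed_of_isAddable hx, weight, curvature]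
      rw [isAddable_iff_rim] at hx
      omega
    · rw [signed_of_isRemovable hx, weight, curvature]
      rw [isRemovable_iff_rim] at hx
      omega

-- A corner with content y + et is indexed by t. Corners have contents in [-M, M], so |t| ≤ M + |y|
-- suffices, and all other t contribute zero curvature.
open Classical in
theorem weight_filter_sortedNodes (he : 0 < e) (y : ℤ) {M K : ℤ}
    (hlow : ∀ x ≤ -M, rim μ x = 0) (hhigh : ∀ x, M ≤ x → rim μ x = x) (hK : M + |y| ≤ K) :
    weight (((sortedNodes e A (y : ZMod e) μ).filter fun x =>
      ∃ t : ℤ, content x = y + e * t ∧ extend A t < rim μ (content x) - rim μ y).map (signed μ)) =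
    ∑ t ∈ Finset.Icc (-K) K, if extend A t < rim μ (y + e * t) - rim μ y then
      curvature (rim μ) (y + e * t) else 0 := by
  have he' : (e : ℤ) ≠ 0 := by omega
  rw [weight_map_signed fun x hx => (mem_sortedNodes.1 (List.mem_of_mem_filter hx)).2,
    ← List.sum_toFinset _ (nodup_sortedNodes.filter _), ← Finset.sum_filter]
  refine Finset.sum_of_injOn (fun x => (content x - y) / e) ?_ ?_ ?_ ?_
  · intro x hx x' hx' hxx'
    simp only [List.coe_toFinset, List.mem_filter, decide_eq_true_eq, Set.mem_ofPred_eq,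
      mem_sortedNodes] at hx hx'
    obtain ⟨t, ht, -⟩ := hx.2
    obtain ⟨t', ht', -⟩ := hx'.2
    simp only [ht, ht', add_sub_cancel_left, Int.mul_ediv_cancel_left _ he'] at hxx'
    exact eq_of_content_eq hx.1.2 hx'.1.2 (by rw [ht, ht', hxx'])
  · intro x hx
    simp only [List.coe_toFinset, List.mem_filter, decide_eq_true_eq, Set.mem_ofPred_eq,
      mem_sortedNodes] at hx
    obtain ⟨⟨-, hx⟩, t, ht, hlt⟩ := hx
    simp only [ht, add_sub_cancel_left, Int.mul_ediv_cancel_left _ he', Finset.coe_filter,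
      Finset.mem_Icc, Set.mem_ofPred_eq]
    rw [ht] at hlt
    refine ⟨?_, hlt⟩
    rw [isAddable_iff_rim, isRemovable_iff_rim] at hx
    have hle : content x ≤ M := by
      by_contra h
      have := hhigh (content x) (by omega)
      have := hhigh (content x - 1) (by omega)
      have := hhigh (content x + 1) (by omega)
      omega
    have hge : -M ≤ content x := by
      by_contra h
      have := hlow (content x) (by omega)
      have := hlow (content x - 1) (by omega)
      have := hlow (content x + 1) (by omega)
      omega
    have hy1 := neg_abs_le y
    have hy2 := le_abs_self y
    have hy3 := abs_nonneg y
    have he1 : (1 : ℤ) ≤ e := by omega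
    constructor
    · by_contra h
      nlinarith
    · by_contra h
      nlinarith
  · intro t ht hnot
    simp only [Finset.mem_filter] at ht
    by_contra hne
    apply hnot
    have b1 := rim_le_rim_succ μ (y + e * t)
    have b2 := rim_succ_le μ (y + e * t)
    have b3 := rim_le_rim_succ μ (y + e * t - 1)
    have b4 := rim_succ_le μ (y + e * t - 1)
    rw [sub_add_cancel] at b3 b4
    have hx : ∃ x : Node, content x = y + e * t ∧ (IsAddable μ x ∨ IsRemovable μ x) := by
      rw [curvature] at hne
      rcases eq_or_ne (rim μ (y + e * t - 1)) (rim μ (y + e * t)) with h | h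
      · obtain ⟨x, hx, -, hx'⟩ := isAddable_of_rim μ h (by omega)
        exact ⟨x, hx, Or.inl hx'⟩
      · obtain ⟨x, hx, -, hx'⟩ := isRemovable_of_rim μ (p := y + e * t) (by omega) (by omega)
        exact ⟨x, hx, Or.inr hx'⟩
    obtain ⟨x, hx, hx'⟩ := hx
    refine ⟨x, ?_, ?_⟩
    · simp only [List.coe_toFinset, List.mem_filter, decide_eq_true_eq, Set.mem_ofPred_eq,
        mem_sortedNodes]
      exact ⟨⟨(residue_eq_intCast_iff x y).2 ⟨t, hx⟩, hx'⟩, t, hx, by rw [hx]; exact ht.2⟩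
    · simp only [hx, add_sub_cancel_left, Int.mul_ediv_cancel_left _ he']
  · intro x hx
    simp only [List.mem_toFinset, List.mem_filter, decide_eq_true_eq] at hx
    obtain ⟨-, t, ht, -⟩ := hx
    simp only [ht, add_sub_cancel_left, Int.mul_ediv_cancel_left _ he']

/-- The signature of a nonempty regular partition does not reduce to a sequence of signs `+`. -/
theorem exists_prefix_weight_neg (he : 0 < e) (hA : IsArmSequence e A)
    (hreg : RimRegular e A (rim μ)) (hne : μ.cells.Nonempty) :
    ∃ (i : ZMod e) (q : List (Sign × Node)), q <+: signature e A i μ ∧ weight q < 0 := by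
  classical
  by_contra! hcon
  obtain ⟨p, hp⟩ := exists_isRemovable μ hne
  set M : ℕ := μ.rowLen 0 + μ.colLen 0 with hMdef
  have hlow : ∀ x ≤ -(M : ℤ), rim μ x = 0 := fun x hx => rim_of_le μ (by omega)
  have hhigh : ∀ x, (M : ℤ) ≤ x → rim μ x = x := fun x hx => rim_of_ge μ (by omega)
  set N : ℕ := M + e * M with hN
  have hsum := sum_curvature_eq_zero hA (rim_le_rim_succ μ) (rim_succ_le μ) hreg hlow hhigh
    (Int.natCast_nonneg M) (N := N) (by push_cast [hN]; exact le_rfl)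
    (Finset.Icc (-(M + N : ℤ)) (M + N))
  have hD : ∀ k ∈ Finset.range (2 * N), _ := fun k hk =>
    weight_filter_sortedNodes (A := A) (μ := μ) he (-(N : ℤ) + (k + 1 : ℕ)) (K := M + N)
      hlow hhigh (by
        have := Finset.mem_range.1 hk
        have : |(-(N : ℤ) + (k + 1 : ℕ))| ≤ N := abs_le.2 (by omega)
        omega)
  rw [← Finset.sum_congr rfl hD] at hsum
  have hsupp : ∀ {j : ZMod e} {x : Node}, x ∈ sortedNodes e A j μ →
      IsAddable μ x ∨ IsRemovable μ x := fun hx => (mem_sortedNodes.1 hx).2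
  -- The nodes above y form an upper set by superadditivity, hence a prefix of the decreasing list.
  have hnonneg := fun (y : ℤ) => hcon (y : ZMod e) _ ((filter_prefix_of_pairwise
    (pairwise_sortedNodes (i := (y : ZMod e)) (μ := μ) he hA)
    (fun x => decide (∃ t : ℤ, content x = y + e * t ∧
      extend A t < rim μ (content x) - rim μ y))
    fun a ha b hb hab => by
      simp only [decide_eq_true_eq]
      rintro ⟨t, h1, h2⟩
      obtain ⟨u, h3, h4⟩ := hab.rim_lt he hA hreg (hsupp hb) (hsupp ha)
      have := hA.extend_add t u
      exact ⟨t + u, by rw [h3, h1]; ring, by omega⟩).map (signed μ))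
  have hzero := (Finset.sum_eq_zero_iff_of_nonneg fun k _ => hnonneg _).1 hsum
  have hp' := (isRemovable_iff_rim μ p).1 hp
  have hpM : content p < M := by
    by_contra h
    have := hhigh (content p) (by omega)
    have := hhigh (content p + 1) (by omega)
    omega
  have hpM' : -(M : ℤ) < content p := by
    by_contra h
    have := hlow (content p) (by omega)
    have := hlow (content p - 1) (by omega)
    omega
  have hMN : M ≤ N := by rw [hN]; exact Nat.le_add_right _ _
  have hzp := hzero (content p + N - 1).toNat (Finset.mem_range.2 (by omega))
  rw [show -(N : ℤ) + (((content p + N - 1).toNat + 1 : ℕ) : ℤ) = content p by omega] at hzp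
  have hpmem : p ∈ sortedNodes e A (content p : ZMod e) μ := mem_sortedNodes.2 ⟨rfl, Or.inr hp⟩
  obtain ⟨l₁, l₂, hl⟩ := List.append_of_mem hpmem
  have hpw := pairwise_sortedNodes (i := (content p : ZMod e)) (μ := μ) he hA
  rw [hl, List.pairwise_append, List.pairwise_cons] at hpw
  -- With y the content of p, the nodes kept by the filter are exactly `l₁`: holding both
  -- inequalities would contradict A_t + A_u ≤ A_{t+u} at t + u = 0.
  have hirr : ∀ x : Node, (x = p ∨ x ∈ l₂) → ¬ ∃ t : ℤ, content x = content p + e * t ∧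
      extend A t < rim μ (content x) - rim μ (content p) := by
    rintro x hx ⟨t, h1, h2⟩
    have hx' : content x = content p ∧ rim μ (content x) = rim μ (content p) ∨
        ∃ u : ℤ, content p = content x + e * u ∧
          extend A u < rim μ (content p) - rim μ (content x) := by
      rcases hx with rfl | hx
      · exact Or.inl ⟨rfl, rfl⟩
      · exact Or.inr ((hpw.2.1.1 x hx).rim_lt he hA hreg
          (hsupp (j := content p) (by rw [hl]; simp [hx])) (Or.inr hp))
    rcases hx' with ⟨h3, h4⟩ | ⟨u, h3, h4⟩
    · have h5 : (e : ℤ) * t = 0 := by omega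
      rcases mul_eq_zero.1 h5 with h6 | h6
      · omega
      · rw [h6, hA.extend_zero] at h2
        omega
    · have h5 : (e : ℤ) * (t + u) = 0 := by rw [mul_add]; omega
      have h7 := hA.extend_add t u
      rcases mul_eq_zero.1 h5 with h6 | h6
      · omega
      · rw [h6, hA.extend_zero] at h7
        omega
  rw [hl, List.filter_append, List.filter_eq_self.2, List.filter_eq_nil_iff.2,
    List.append_nil] at hzp
  · have h1 := hcon (content p : ZMod e) (l₁.map (signed μ) ++ [(Sign.minus, p)])
      ⟨l₂.map (signed μ), by
        rw [signature_eq_map, hl, List.map_append, List.map_cons, signed_of_isRemovable hp,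
          List.append_assoc]
        rfl⟩
    rw [weight_append, hzp] at h1
    simp [weight] at h1
  · intro x hx
    simpa using hirr x (List.mem_cons.1 hx)
  · intro x hx
    simpa using (hpw.2.2 x hx p List.mem_cons_self).rim_lt he hA hreg (Or.inr hp)
      (hsupp (j := content p) (by rw [hl]; simp [hx]))

theorem weight_nonpos {l : List Node} (h : ∀ x ∈ l, ¬ IsAddable μ x) :
    weight (l.map (signed μ)) ≤ 0 := by
  induction l with
  | nil => exact le_rfl
  | cons x l ih =>
    have := ih fun y hy => h y (List.mem_cons_of_mem _ hy)
    rw [List.map_cons, signed_of_not_isAddable (h x List.mem_cons_self), weight]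
    omega

/-- Every removable node after a good node is preceded by an addable node after it. -/
theorem exists_isAddable_between (he : 0 < e) (hA : IsArmSequence e A) {p r : Node}
    {l₁ l₂ : List Node} (hl : sortedNodes e A i μ = l₁ ++ p :: l₂)
    (h₂ : ∀ q, q <+: l₂.map (signed μ) → 0 ≤ weight q) (hr : r ∈ sortedNodes e A i μ)
    (hr' : IsRemovable μ r) (hrp : NodeLT e A r p) :
    ∃ q, IsAddable μ q ∧ NodeLT e A r q ∧ NodeLT e A q p := by
  have hpw := pairwise_sortedNodes (i := i) (μ := μ) he hA
  rw [hl, List.pairwise_append, List.pairwise_cons] at hpw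
  have hrl : r ∈ l₂ := by
    rw [hl, List.mem_append, List.mem_cons] at hr
    rcases hr with h | rfl | h
    · exact absurd hrp (NodeLT.asymm he hA (hpw.2.2 r h p List.mem_cons_self))
    · exact absurd rfl hrp.1
    · exact h
  obtain ⟨l₃, l₄, rfl⟩ := List.append_of_mem hrl
  have h3 := h₂ ((l₃ ++ [r]).map (signed μ)) (List.IsPrefix.map _ ⟨l₄, by simp⟩)
  rw [List.map_append, weight_append, List.map_singleton, signed_of_isRemovable hr'] at h3
  simp only [weight] at h3
  obtain ⟨q, hq, hq'⟩ : ∃ q ∈ l₃, IsAddable μ q := by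
    by_contra! h
    have := weight_nonpos h
    omega
  refine ⟨q, hq', ?_, hpw.2.1.1 q (by simp [hq])⟩
  exact (List.pairwise_append.1 hpw.2.1.2).2.2 q hq r List.mem_cons_self

/-- Removing p lowers the rim by 1 at a single content, so a new forbidden pair must involve it.
Regularity of the neighbouring pairs in μ then exhibits a removable r exactly one above the
threshold from p. -/
theorem rimRegular_erase (he : 2 ≤ e) (hA : IsArmSequence e A) (hreg : RimRegular e A (rim μ))
    {p : Node} (hp : IsRemovable μ p) (hν : ν.cells = μ.cells.erase p)
    (hbetween : ∀ r, IsRemovable μ r → residue e r = residue e p → NodeLT e A r p →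
      ∃ q, IsAddable μ q ∧ NodeLT e A r q ∧ NodeLT e A q p) :
    RimRegular e A (rim ν) := by
  have he0 : 0 < e := by omega
  have hp' := (isRemovable_iff_rim μ p).1 hp
  -- The comparisons r ≺ q ≺ p each cost at least 1, and p being removable costs one more: A_v + A_u
  -- + 2 ≤ A_s with s = v + u, against A_s ≤ A_v + A_u + 1.
  have key : ∀ (s x : ℤ), content p = x + e * s →
      rim μ (content p) - rim μ x = extend A s + 1 → rim μ (x - 1) = rim μ x - 1 →
      rim μ (x + 1) = rim μ x → False := by
    intro s x hx hdiff h1 h2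
    obtain ⟨r, rfl, hr2, hr⟩ := isRemovable_of_rim μ h1 h2
    obtain ⟨q, hq, hrq, hqp⟩ := hbetween r hr
      ((residue_eq_intCast_iff r (content p)).2 ⟨-s, by rw [hx]; ring⟩)
      ((nodeLT_iff he0 hA r p).2 ⟨s, hx, by omega⟩)
    obtain ⟨v, hv1, hv2⟩ := hrq.rim_lt he0 hA hreg (Or.inr hr) (Or.inl hq)
    obtain ⟨u, hu1, hu2⟩ := (nodeLT_iff he0 hA q p).1 hqp
    have hq' := (isAddable_iff_rim μ q).1 hq
    have huv : v + u = s := by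
      have : (e : ℤ) * (v + u) = e * s := by rw [mul_add]; omega
      exact mul_left_cancel₀ (by omega) this
    have := hA.extend_add v u
    rw [huv] at this
    omega
  intro t w z ht hz hh
  have hzw : w + 1 < z := by nlinarith
  rw [rim_of_erase hp hν, rim_of_erase hp hν, rim_of_erase hp hν, rim_of_erase hp hν] at hh
  have hreg0 := hreg t w z ht hz
  have hreg1 := hreg t (w - 1) (z - 1) ht (by rw [hz]; ring)
  have hreg2 := hreg t (w + 1) (z + 1) ht (by rw [hz]; ring)
  have b1 := rim_le_rim_succ μ w
  have b2 := rim_succ_le μ w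
  have b3 := rim_le_rim_succ μ z
  have b4 := rim_succ_le μ z
  have b5 := rim_le_rim_succ μ (w + 1)
  have b6 := rim_succ_le μ (w + 1)
  have b7 := rim_le_rim_succ μ (z - 1)
  have b8 := rim_succ_le μ (z - 1)
  have hopp := extend_neg A ht
  rw [sub_add_cancel] at hreg1 b7 b8
  rw [sub_add_cancel] at hreg1
  generalize hP : content p = P at *
  by_cases c1 : w = P
  · subst c1
    rw [if_neg (by omega), if_pos rfl, if_neg (by omega), if_neg (by omega)] at hh
    refine key (-t) z (by rw [hz]; ring) ?_ ?_ ?_ <;> omega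
  -- Here, and for z = P, the two steps of the rim would have to differ by 2.
  by_cases c2 : w + 1 = P
  · subst c2
    rw [if_neg (by omega), if_neg (by omega), if_neg (by omega), if_pos rfl] at hh
    omega
  by_cases c3 : z = P
  · subst c3
    rw [if_pos rfl, if_neg (by omega), if_neg (by omega), if_neg (by omega)] at hh
    omega
  by_cases c4 : z + 1 = P
  · subst c4
    rw [if_neg (by omega), if_neg (by omega), if_pos rfl, if_neg (by omega)] at hh
    rw [add_sub_cancel_right] at hp'
    refine key t (w + 1) (by rw [hz]; ring) ?_ ?_ ?_
    · omega
    · rw [add_sub_cancel_right]; omega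
    · omega
  rw [if_neg c3, if_neg c1, if_neg c4, if_neg c2] at hh
  exact hreg0 hh

/-- Since e ≥ 2, contents of one residue are never adjacent, so removing p leaves the rim unchanged
around every other node of its residue. -/
theorem rim_erase_eq (he : 2 ≤ e) {p : Node} (hp : IsRemovable μ p)
    (hν : ν.cells = μ.cells.erase p) {x : Node} (hx : residue e x = residue e p)
    (hxp : content x ≠ content p) :
    rim ν (content x) = rim μ (content x) ∧ rim ν (content x - 1) = rim μ (content x - 1) ∧
      rim ν (content x + 1) = rim μ (content x + 1) := by
  obtain ⟨t, ht⟩ := (residue_eq_intCast_iff x (content p)).1 hx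
  have hdvd : ¬ (e : ℤ) ∣ 1 := fun h => by
    have := Int.le_of_dvd one_pos h
    omega
  have h1 : content x - 1 ≠ content p := fun h => hdvd ⟨t, by omega⟩
  have h2 : content x + 1 ≠ content p := fun h => hdvd ⟨-t, by rw [mul_neg]; omega⟩
  simp only [rim_of_erase hp hν, if_neg hxp, if_neg h1, if_neg h2, and_self]

theorem isAddable_erase {p : Node} (hp : IsRemovable μ p) (hν : ν.cells = μ.cells.erase p) :
    IsAddable ν p := by
  refine ⟨fun h => ?_, μ, ?_⟩
  · rw [← YoungDiagram.mem_cells, hν] at h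
    exact Finset.notMem_erase _ _ h
  · rw [hν, Finset.insert_erase ((YoungDiagram.mem_cells _).2 hp.1)]

theorem signatureNodes_erase (he : 2 ≤ e) {p : Node} (hp : IsRemovable μ p)
    (hν : ν.cells = μ.cells.erase p) (hi : residue e p = i) :
    signatureNodes e i ν = signatureNodes e i μ := by
  ext x
  rw [mem_signatureNodes, mem_signatureNodes]
  refine and_congr_right fun hx => ?_
  by_cases hxp : content x = content p
  · have hp' := isAddable_erase hp hν
    constructor
    · intro h
      rw [eq_of_content_eq h (Or.inl hp') hxp]
      exact Or.inr hp
    · intro h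
      rw [eq_of_content_eq h (Or.inr hp) hxp]
      exact Or.inl hp'
  · obtain ⟨h1, h2, h3⟩ := rim_erase_eq he hp hν (hx.trans hi.symm) hxp
    rw [isAddable_iff_rim, isAddable_iff_rim, isRemovable_iff_rim, isRemovable_iff_rim, h1, h2, h3]

theorem signed_erase (he : 2 ≤ e) {p x : Node} (hp : IsRemovable μ p)
    (hν : ν.cells = μ.cells.erase p) (hx : residue e x = residue e p)
    (hx' : IsAddable μ x ∨ IsRemovable μ x) (hxp : x ≠ p) : signed ν x = signed μ x := by
  obtain ⟨h1, h2, h3⟩ := rim_erase_eq he hp hν hx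
    fun h => hxp (eq_of_content_eq hx' (Or.inr hp) h)
  have : IsAddable ν x ↔ IsAddable μ x := by
    rw [isAddable_iff_rim, isAddable_iff_rim, h1, h2, h3]
  by_cases hadd : IsAddable μ x
  · rw [signed_of_isAddable hadd, signed_of_isAddable (this.2 hadd)]
  · rw [signed_of_not_isAddable hadd, signed_of_not_isAddable (this.not.2 hadd)]

/-- Every nonempty regular partition is `f_i` of a regular partition for some `i`. -/
theorem exists_fOpEq (he : 2 ≤ e) (hA : IsArmSequence e A) (hreg : IsRegular e A μ)
    (hne : μ.cells.Nonempty) :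
    ∃ (i : ZMod e) (ν : YoungDiagram), IsRegular e A ν ∧ FOpEq e A i ν μ := by
  have he0 : 0 < e := by omega
  rw [isRegular_iff_rimRegular he0] at hreg
  obtain ⟨i, hpre⟩ := exists_prefix_weight_neg he0 hA hreg hne
  obtain ⟨l₁', p, l₂', hl', h₁, h₂⟩ := exists_split_of_weight_neg _ hpre
  rw [signature_eq_map, List.map_eq_append_iff] at hl'
  obtain ⟨l₁, l, hl, rfl, hl'⟩ := hl'
  obtain ⟨p', l₂, rfl, hp, rfl⟩ := List.map_eq_cons_iff.1 hl'
  obtain rfl : p' = p := congrArg Prod.snd hp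
  have hmem := fun x => mem_sortedNodes (A := A) (i := i) (μ := μ) (x := x)
  have hpi := (hmem p').1 (by rw [hl]; simp)
  have hrem : IsRemovable μ p' := by
    refine hpi.2.resolve_left fun h => ?_
    rw [signed_of_isAddable h] at hp
    cases congrArg Prod.fst hp
  obtain ⟨ν, hν⟩ := hrem.2
  refine ⟨i, ν, ?_, p', ?_, ?_⟩
  · rw [isRegular_iff_rimRegular he0]
    -- Each removable r ≺ p of this residue is a - cancelled by a + lying between p and r, which is
    -- the required addable node.
    exact rimRegular_erase he hA hreg hrem hν fun r hr hri hrp =>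
      exists_isAddable_between he0 hA hl h₂ ((hmem r).2 ⟨hri.trans hpi.1, Or.inr hr⟩) hr hrp
  · have hnd := nodup_sortedNodes (e := e) (A := A) (i := i) (μ := μ)
    rw [hl] at hnd
    have hcongr : ∀ x ∈ sortedNodes e A i μ, x ≠ p' → signed ν x = signed μ x :=
      fun x hx hxp => signed_erase he hrem hν (((hmem x).1 hx).1.trans hpi.1.symm)
        ((hmem x).1 hx).2 hxp
    rw [hl] at hcongr
    have hsorted : sortedNodes e A i ν = l₁ ++ p' :: l₂ := by
      rw [← hl, sortedNodes, sortedNodes, signatureNodes_erase he hrem hν hpi.1]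
    rw [IsCogood, signature_eq_map, hsorted, List.map_append, List.map_cons,
      signed_of_isAddable (isAddable_erase hrem hν),
      List.map_congr_left (l := l₁) (g := signed μ), List.map_congr_left (l := l₂) (g := signed μ)]
    · exact head?_plusNodes_reduction _ _ _ h₁ h₂
    · intro x hx
      refine hcongr x (by simp [hx]) ?_
      rintro rfl
      exact (List.nodup_cons.1 (List.nodup_append.1 hnd).2.1).1 hx
    · intro x hx
      refine hcongr x (by simp [hx]) ?_
      rintro rfl
      exact (List.nodup_append.1 hnd).2.2 x hx x List.mem_cons_self rfl
  · rw [hν, Finset.insert_erase ((YoungDiagram.mem_cells _).2 hrem.1)]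

theorem FOpEq.unique {ρ : YoungDiagram} (h₁ : FOpEq e A i μ ν) (h₂ : FOpEq e A i μ ρ) :
    ν = ρ := by
  obtain ⟨x, hx, hν⟩ := h₁
  obtain ⟨y, hy, hρ⟩ := h₂
  obtain rfl : x = y := Option.some.inj (hx.symm.trans hy)
  exact YoungDiagram.ext (hν.trans hρ.symm)

theorem mem_of_mem_plusNodes {l : List (Sign × Node)} {x : Node} (h : x ∈ plusNodes l) :
    (Sign.plus, x) ∈ l := by
  induction l with
  | nil => cases h
  | cons a l ih =>
    obtain ⟨_ | _, y⟩ := a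
    · rcases List.mem_cons.1 h with rfl | h
      · exact List.mem_cons_self
      · exact List.mem_cons_of_mem _ (ih h)
    · exact List.mem_cons_of_mem _ (ih h)

theorem reduction_subset (l : List (Sign × Node)) : reduction l ⊆ l := by
  induction l with
  | nil => exact List.Subset.refl _
  | cons a l ih =>
    have hcons : consReduce a (reduction l) ⊆ a :: reduction l := by
      generalize reduction l = m
      obtain ⟨_ | _, x⟩ := a
      · rcases m with _ | ⟨⟨_ | _, y⟩, m⟩
        · exact List.Subset.refl _
        · exact List.Subset.refl _
        · exact fun b hb => List.mem_cons_of_mem _ (List.mem_cons_of_mem _ hb)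
      · exact List.Subset.refl _
    exact List.Subset.trans hcons (List.cons_subset_cons a ih)

theorem IsCogood.isAddable {x : Node} (h : IsCogood e A i μ x) : IsAddable μ x := by
  have h1 := reduction_subset _ (mem_of_mem_plusNodes (List.mem_of_mem_head? h))
  rw [signature_eq_map] at h1
  obtain ⟨y, -, hy⟩ := List.mem_map.1 h1
  by_contra hx
  obtain rfl : y = x := congrArg Prod.snd hy
  simp [signed, hx] at hy

theorem FOpEq.card_eq (h : FOpEq e A i μ ν) : ν.card = μ.card + 1 := by
  obtain ⟨x, hx, hν⟩ := h
  rw [YoungDiagram.card, hν, Finset.card_insert_of_notMem]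
  exact fun h => hx.isAddable.1 ((YoungDiagram.mem_cells _).1 h)

end Signature

/-! ### Rigidity of graded graphs with unique successors -/

theorem isCrystalIso_iff_eq_refl {I V : Type} (G : LabelledDigraph I V) (size : V → ℕ)
    (hunique : ∀ i b c c', G.arrow i b c → G.arrow i b c' → c = c')
    (hsize : ∀ i b c, G.arrow i b c → size c = size b + 1)
    (hpred : ∀ c, size c ≠ 0 → ∃ i b, G.arrow i b c)
    (hzero : ∀ b c, size b = 0 → size c = 0 → b = c) (α : V ≃ V) :
    IsCrystalIso G G α ↔ α = Equiv.refl _ := by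
  constructor
  · intro hα
    have key : ∀ (n : ℕ) (b : V), size b = n → α b = b := by
      intro n
      induction n with
      | zero =>
        intro b hb
        refine hzero _ _ ?_ hb
        -- A predecessor of `α b` pulls back along α to a predecessor of `b`, which has size 0.
        by_contra h
        obtain ⟨i, c, hc⟩ := hpred _ h
        rw [← α.apply_symm_apply c, ← hα] at hc
        have := hsize _ _ _ hc
        omega
      | succ n ih =>
        intro b hb
        obtain ⟨i, c, hc⟩ := hpred b (by omega)
        have h1 := hsize _ _ _ hc
        have h2 := (hα i c b).1 hc
        rw [ih c (by omega)] at h2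
        exact hunique _ _ _ _ h2 hc
    exact Equiv.ext fun b => key _ b rfl
  · rintro rfl i b c
    rfl

end ArmCrystal

open ArmCrystal in
theorem proposition3p8 (e : ℕ) (he : 2 ≤ e) (A : ℕ → ℤ) (hA : ArmCrystal.IsArmSequence e A) :
    (∀ α : ArmCrystal.RegularPartition e A ≃ ArmCrystal.RegularPartition e A,
      ArmCrystal.IsCrystalIso (ArmCrystal.crystal e A) (ArmCrystal.crystal e A) α ↔
        α = Equiv.refl _) ∧
    (∀ (n : ℕ) (α : ArmCrystal.sizeAtMost e A n ≃ ArmCrystal.sizeAtMost e A n),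
      ArmCrystal.IsCrystalIso (ArmCrystal.truncatedCrystal e A n)
          (ArmCrystal.truncatedCrystal e A n) α ↔
        α = Equiv.refl _) := by
  have hempty : ∀ μ ν : YoungDiagram, μ.card = 0 → ν.card = 0 → μ = ν := fun μ ν hμ hν =>
    YoungDiagram.ext ((Finset.card_eq_zero.1 hμ).trans (Finset.card_eq_zero.1 hν).symm)
  have hne : ∀ μ : YoungDiagram, μ.card ≠ 0 → μ.cells.Nonempty := fun μ h =>
    Finset.card_ne_zero.1 h
  constructor
  · refine isCrystalIso_iff_eq_refl _ (fun b => b.1.card) ?_ ?_ ?_ ?_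
    · exact fun i b c c' h h' => Subtype.ext (FOpEq.unique h h')
    · exact fun i b c h => FOpEq.card_eq h
    · intro c hc
      obtain ⟨i, ν, hν, h⟩ := exists_fOpEq he hA c.2 (hne _ hc)
      exact ⟨i, ⟨ν, hν⟩, h⟩
    · exact fun b c hb hc => Subtype.ext (hempty _ _ hb hc)
  · intro n
    refine isCrystalIso_iff_eq_refl _ (fun b => b.1.1.card) ?_ ?_ ?_ ?_
    · exact fun i b c c' h h' => Subtype.ext (Subtype.ext (FOpEq.unique h h'))
    · exact fun i b c h => FOpEq.card_eq h
    · intro c hc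
      obtain ⟨i, ν, hν, h⟩ := exists_fOpEq he hA c.1.2 (hne _ hc)
      have hc' : c.1.1.card ≤ n * e := c.2
      exact ⟨i, ⟨⟨ν, hν⟩, show ν.card ≤ n * e by have := h.card_eq; omega⟩, h⟩
    · exact fun b c hb hc => Subtype.ext (Subtype.ext (hempty _ _ hb hc))
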